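/- Let $V$ be the $\mathbb{Q}$-vector space of finitely supported sequences of rationals, and let $\mathcal{P}\subseteq\mathbb{R}^V$ be the space of all pseudonorms on $V$ (functions $\mu\colon V\to\mathbb{R}$ with $\mu(v+w)\le\mu(v)+\mu(w)$ and $\mu(qv)=|q|\mu(v)$ for $v,w\in V$ and $q\in\mathbb{Q}$), with the topology of pointwise convergence on $V$. Each $\mu\in\mathcal{P}$ extends uniquely to a pseudonorm, again denoted $\mu$, on the real vector space $c_{00}$ of finitely supported real sequences; let $X_\mu$ be the real Banach space obtained as the completion of $c_{00}/\{x:\mu(x)=0\}$ with the norm induced by $\mu$. Let $\mathcal{P}_\infty=\{\mu\in\mathcal{P}:\dim X_\mu=\infty\}$, with the topology inherited from $\mathcal{P}$. For a real Banach space $X$, $F\subseteq X^*$ and $\varepsilon>0$ put $$s_\varepsilon(F)=\{x^*\in F:\ \operatorname{diam}(U\cap F)\ge\varepsilon\text{ for every }w^*\text{-open }U\ni x^*\}$$ (the diameter being taken in the norm of $X^*$), and let $s_\varepsilon^0(F)=F$, $s_\varepsilon^{\beta+1}(F)=s_\varepsilon(s_\varepsilon^\beta(F))$, and $s_\varepsilon^\beta(F)=\bigcap_{\gamma<\beta}s_\varepsilon^\gamma(F)$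 for limit ordinals $\beta$. Let $Sz(X,\varepsilon)$ be the least ordinal $\beta$ such that $s_\varepsilon^\beta(B_{X^*})=\emptyset$ if such an ordinal exists, and $\infty$ otherwise, where $B_{X^*}$ is the closed unit ball of $X^*$. Let $Sz(X)=\sup_{\varepsilon>0}Sz(X,\varepsilon)$. In a metrizable space, $\boldsymbol{\Sigma}^0_1$-sets are the open sets; $\boldsymbol{\Pi}^0_\xi$-sets are the complements of $\boldsymbol{\Sigma}^0_\xi$-sets; and for $\xi>1$ the $\boldsymbol{\Sigma}^0_\xi$-sets are the countable unions $\bigcup_n A_n$ where each $A_n$ is a $\boldsymbol{\Pi}^0_{\xi_n}$-set for some $1\le\xi_n<\xi$. **Theorem.** For every ordinal $\alpha$ with $1\le\alpha<\omega_1$, the set $$\{\mu\in\mathcal{P}_\infty:\ Sz(X_\mu)\le\omega^\alpha\}$$ is a $\boldsymbol{\Pi}^0_{\omega^\alpha+1}$-set in $\mathcal{P}_\infty$. -/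

import Mathlib

open Set

namespace BanachCoding

/-! ### The Borel hierarchy -/

/-- `IsSigma a A`: the set `A` belongs to the additive Borel class `Σ⁰ₐ` of the space `T`.
`Σ⁰₁` consists of the open sets; for `a > 1`, `Σ⁰ₐ` consists of the unions of sequences `A n`
such that the complement of `A n` is `Σ⁰_{b n}` (that is, `A n` is `Π⁰_{b n}`), `1 ≤ b n < a`. -/
inductive IsSigma {T : Type*} [TopologicalSpace T] : Ordinal.{0} → Set T → Prop
  | isOpen (U : Set T) (hU : IsOpen U) : IsSigma 1 U
  | iUnion (a : Ordinal.{0}) (ha : 1 < a) (A : ℕ → Set T) (b : ℕ → Ordinal.{0})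
      (hb : ∀ n, 1 ≤ b n) (hba : ∀ n, b n < a) (hA : ∀ n, IsSigma (b n) (A n)ᶜ) :
      IsSigma a (⋃ n, A n)

/-- The multiplicative Borel class `Π⁰ₐ`: complements of `Σ⁰ₐ`-sets. -/
def IsPi {T : Type*} [TopologicalSpace T] (a : Ordinal.{0}) (A : Set T) : Prop :=
  IsSigma a Aᶜ

/-! ### The coding of separable Banach spaces by pseudonorms -/

/-- The rational vector space of all finitely supported sequences of rationals. -/
abbrev V : Type := ℕ →₀ ℚ

/-- The pseudonorms on `V`: functions `μ : V → ℝ` with `μ (v + w) ≤ μ v + μ w` and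
`μ (q • v) = |q| * μ v` for rational `q`. -/
abbrev Pseudonorms : Type := Seminorm ℚ V

/-- The topology inherited from `ℝ^V` (pointwise convergence on `V`). -/
noncomputable instance : TopologicalSpace Pseudonorms :=
  TopologicalSpace.induced (fun (μ : Pseudonorms) (v : V) => μ v) inferInstance

/-- The inclusion of `V` into `c₀₀`, the space of finitely supported real sequences. -/
noncomputable def ratInclusion : V →+ (ℕ →₀ ℝ) :=
  Finsupp.mapRange.addMonoidHom (Rat.castHom ℝ).toAddMonoidHom

theorem ratInclusion_apply (v : V) (i : ℕ) : ratInclusion v i = (v i : ℝ) := by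
  simp [ratInclusion]

/-- The weighted `ℓ₁`-pseudonorm `∑ |xᵢ| μ(eᵢ)` on `c₀₀`. -/
noncomputable def weight (μ : Pseudonorms) (x : ℕ →₀ ℝ) : ℝ :=
  x.sum fun i t => |t| * μ (Finsupp.single i 1)

theorem weight_eq (μ : Pseudonorms) (x : ℕ →₀ ℝ) (s : Finset ℕ) (hs : x.support ⊆ s) :
    weight μ x = ∑ i ∈ s, |x i| * μ (Finsupp.single i 1) :=
  Finsupp.sum_of_support_subset _ hs _ (by simp)

theorem weight_nonneg (μ : Pseudonorms) (x : ℕ →₀ ℝ) : 0 ≤ weight μ x :=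
  Finset.sum_nonneg fun _ _ => mul_nonneg (abs_nonneg _) (apply_nonneg μ _)

theorem weight_zero (μ : Pseudonorms) : weight μ 0 = 0 := by
  simp [weight]

theorem weight_add_le (μ : Pseudonorms) (x y : ℕ →₀ ℝ) :
    weight μ (x + y) ≤ weight μ x + weight μ y := by
  classical
  rw [weight_eq μ (x + y) (x.support ∪ y.support) Finsupp.support_add,
    weight_eq μ x (x.support ∪ y.support) Finset.subset_union_left,
    weight_eq μ y (x.support ∪ y.support) Finset.subset_union_right, ← Finset.sum_add_distrib]
  refine Finset.sum_le_sum fun i _ => ?_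
  rw [← add_mul]
  exact mul_le_mul_of_nonneg_right (abs_add_le _ _) (apply_nonneg μ _)

theorem weight_smul (μ : Pseudonorms) (t : ℝ) (x : ℕ →₀ ℝ) :
    weight μ (t • x) = |t| * weight μ x := by
  rw [weight_eq μ (t • x) x.support Finsupp.support_smul, weight_eq μ x x.support subset_rfl,
    Finset.mul_sum]
  refine Finset.sum_congr rfl fun i _ => ?_
  simp [abs_mul, mul_assoc]

theorem le_weight (μ : Pseudonorms) (v : V) : μ v ≤ weight μ (ratInclusion v) := by
  induction v using Finsupp.induction_linear with
  | zero => simp [weight]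
  | add v w hv hw =>
    classical
    rw [weight_eq μ _ (v + w).support (fun i hi => by
      simpa [ratInclusion_apply, ← Rat.cast_add] using hi)]
    conv_lhs => rw [← Finsupp.sum_single (v + w)]
    refine (Finset.le_sum_of_subadditive μ (map_zero μ).le (map_add_le_add μ) _ _).trans
      (Finset.sum_le_sum fun i _ => ?_)
    have h : Finsupp.single i ((v + w) i) = ((v + w) i) • (Finsupp.single i 1 : V) := by simp
    rw [h, map_smul_eq_mul, ratInclusion_apply, ← Rat.norm_cast_real, Real.norm_eq_abs]
  | single i q =>
    have h : Finsupp.single i q = q • (Finsupp.single i 1 : V) := by simp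
    rw [weight_eq μ _ {i} (fun j hj => by
      simp only [Finsupp.mem_support_iff, ratInclusion_apply] at hj
      by_contra hne
      exact hj (by simp [Ne.symm (Finset.notMem_singleton.mp hne)]))]
    rw [Finset.sum_singleton, ratInclusion_apply]
    conv_lhs => rw [h]
    rw [map_smul_eq_mul]
    rw [← Rat.norm_cast_real, Real.norm_eq_abs]
    simp

/-- The value at `x` of the extension of `μ` to `c₀₀`. -/
noncomputable def extendFun (μ : Pseudonorms) (x : ℕ →₀ ℝ) : ℝ :=
  ⨅ v : V, (μ v + weight μ (x - ratInclusion v))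

theorem extendFun_bddBelow (μ : Pseudonorms) (x : ℕ →₀ ℝ) :
    BddBelow (range fun v : V => μ v + weight μ (x - ratInclusion v)) :=
  ⟨0, by
    rintro _ ⟨v, rfl⟩
    exact add_nonneg (apply_nonneg μ _) (weight_nonneg _ _)⟩

theorem extendFun_le (μ : Pseudonorms) (x : ℕ →₀ ℝ) (v : V) :
    extendFun μ x ≤ μ v + weight μ (x - ratInclusion v) :=
  ciInf_le (extendFun_bddBelow μ x) v

theorem extendFun_nonneg (μ : Pseudonorms) (x : ℕ →₀ ℝ) : 0 ≤ extendFun μ x :=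
  le_ciInf fun _ => add_nonneg (apply_nonneg μ _) (weight_nonneg _ _)

theorem extendFun_add_le (μ : Pseudonorms) (x y : ℕ →₀ ℝ) :
    extendFun μ (x + y) ≤ extendFun μ x + extendFun μ y := by
  refine le_ciInf_add_ciInf fun v w => (extendFun_le μ (x + y) (v + w)).trans ?_
  have h1 := map_add_le_add μ v w
  have h2 := weight_add_le μ (x - ratInclusion v) (y - ratInclusion w)
  have h3 : x + y - ratInclusion (v + w) = x - ratInclusion v + (y - ratInclusion w) := by
    rw [map_add]; abel
  rw [h3]
  linarith

theorem extendFun_le_weight (μ : Pseudonorms) (x : ℕ →₀ ℝ) : extendFun μ x ≤ weight μ x := by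
  simpa using extendFun_le μ x 0

theorem extendFun_rat_smul_le (μ : Pseudonorms) (q : ℚ) (x : ℕ →₀ ℝ) :
    extendFun μ ((q : ℝ) • x) ≤ |(q : ℝ)| * extendFun μ x := by
  have key : ∀ v : V, extendFun μ ((q : ℝ) • x)
      ≤ |(q : ℝ)| * (μ v + weight μ (x - ratInclusion v)) := fun v => by
    have h : (q : ℝ) • x - ratInclusion (q • v) = (q : ℝ) • (x - ratInclusion v) := by
      ext i; simp [ratInclusion_apply, mul_sub]
    refine (extendFun_le μ _ (q • v)).trans (le_of_eq ?_)
    rw [h, weight_smul, map_smul_eq_mul, mul_add, ← Rat.norm_cast_real, Real.norm_eq_abs]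
  rw [extendFun, extendFun, Real.mul_iInf_of_nonneg (abs_nonneg _)]
  exact le_ciInf key

theorem extendFun_smul_le (μ : Pseudonorms) (t : ℝ) (x : ℕ →₀ ℝ) :
    extendFun μ (t • x) ≤ |t| * extendFun μ x := by
  have hrat : ∀ q : ℚ, extendFun μ (t • x) ≤ |(q : ℝ)| * extendFun μ x
      + |t - q| * weight μ x := fun q => by
    have h : t • x = (q : ℝ) • x + (t - q) • x := by rw [← add_smul]; simp
    calc extendFun μ (t • x) = extendFun μ ((q : ℝ) • x + (t - q) • x) := by rw [← h]
      _ ≤ _ := extendFun_add_le μ _ _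
      _ ≤ _ := add_le_add (extendFun_rat_smul_le μ q x)
          ((extendFun_le_weight μ _).trans (weight_smul μ _ _).le)
  have hcl : IsClosed {s : ℝ | extendFun μ (t • x) ≤ |s| * extendFun μ x
      + |t - s| * weight μ x} := isClosed_le (by fun_prop) (by fun_prop)
  have hall := Rat.denseRange_cast (𝕜 := ℝ) |>.induction_on (p := fun s => extendFun μ (t • x)
    ≤ |s| * extendFun μ x + |t - s| * weight μ x) t hcl hrat
  simpa using hall

/-- The extension of a pseudonorm `μ` on `V` to a pseudonorm on the real vector space `c₀₀`. -/
noncomputable def extend (μ : Pseudonorms) : Seminorm ℝ (ℕ →₀ ℝ) :=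
  Seminorm.ofSMulLE (extendFun μ)
    (le_antisymm ((extendFun_le_weight μ 0).trans (weight_zero μ).le) (extendFun_nonneg μ 0))
    (extendFun_add_le μ) (fun t x => extendFun_smul_le μ t x)

/-- `extend μ` agrees with `μ` on `V`. -/
theorem extend_ratInclusion (μ : Pseudonorms) (v : V) : extend μ (ratInclusion v) = μ v := by
  change extendFun μ (ratInclusion v) = μ v
  refine le_antisymm ((extendFun_le μ _ v).trans (by simp [weight_zero])) (le_ciInf fun u => ?_)
  have h1 := map_add_le_add μ u (v - u)
  have h2 := le_weight μ (v - u)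
  rw [map_sub ratInclusion] at h2
  rw [add_sub_cancel] at h1
  linarith

/-- A pseudonorm on `c₀₀` which agrees with `μ` on `V` equals `extend μ`. -/
theorem extend_unique (μ : Pseudonorms) (p : Seminorm ℝ (ℕ →₀ ℝ))
    (hp : ∀ v : V, p (ratInclusion v) = μ v) : p = extend μ := by
  have hW : ∀ (r : Seminorm ℝ (ℕ →₀ ℝ)), (∀ v : V, r (ratInclusion v) = μ v) →
      ∀ x, r x ≤ weight μ x := fun r hr x => by
    conv_lhs => rw [← Finsupp.sum_single x]
    refine (Finset.le_sum_of_subadditive r (map_zero r).le (map_add_le_add r) _ _).trans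
      (Finset.sum_le_sum fun i _ => ?_)
    have h : Finsupp.single i (x i) = (x i) • ratInclusion (Finsupp.single i 1) := by
      ext j
      rw [Finsupp.smul_apply, ratInclusion_apply, Finsupp.single_apply, Finsupp.single_apply]
      split_ifs <;> simp
    rw [h, map_smul_eq_mul, hr, Real.norm_eq_abs]
  have happrox : ∀ (x : ℕ →₀ ℝ) (δ : ℝ), 0 < δ → ∃ v : V,
      weight μ (x - ratInclusion v) ≤ δ * ∑ i ∈ x.support, μ (Finsupp.single i 1) :=
    fun x δ hδ => by
    choose q hq using fun i => exists_rat_near (x i) hδ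
    refine ⟨Finsupp.onFinset x.support (fun i => if x i = 0 then 0 else q i) (by simp_all), ?_⟩
    rw [weight_eq μ _ x.support (fun i hi => by
      simp only [Finsupp.mem_support_iff, Finsupp.sub_apply, ratInclusion_apply,
        Finsupp.onFinset_apply] at hi ⊢
      intro h0
      simp [h0] at hi), Finset.mul_sum]
    refine Finset.sum_le_sum fun i hi => mul_le_mul_of_nonneg_right ?_ (apply_nonneg μ _)
    have hi' : x i ≠ 0 := Finsupp.mem_support_iff.mp hi
    simpa [ratInclusion_apply, hi'] using (hq i).le
  have hle : ∀ (r s : Seminorm ℝ (ℕ →₀ ℝ)), (∀ v : V, r (ratInclusion v) = μ v) →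
      (∀ v : V, s (ratInclusion v) = μ v) → ∀ x, r x ≤ s x := fun r s hr hs x => by
    set C := ∑ i ∈ x.support, μ (Finsupp.single i 1) with hC
    have hC0 : 0 ≤ C := Finset.sum_nonneg fun _ _ => apply_nonneg μ _
    refine le_of_forall_pos_le_add fun η hη => ?_
    obtain ⟨v, hv⟩ := happrox x (η / (2 * (C + 1))) (by positivity)
    have h1 : r x ≤ r (ratInclusion v) + r (x - ratInclusion v) := by
      simpa using map_add_le_add r (ratInclusion v) (x - ratInclusion v)
    have h2 : s (ratInclusion v) ≤ s x + s (x - ratInclusion v) := by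
      simpa using map_sub_le_add s x (x - ratInclusion v)
    have h3 := hW r hr (x - ratInclusion v)
    have h4 := hW s hs (x - ratInclusion v)
    have h5 : η / (2 * (C + 1)) * C ≤ η / 2 := by
      rw [div_mul_eq_mul_div, div_le_div_iff₀ (by positivity) (by positivity)]
      nlinarith
    rw [hr] at h1
    rw [hs] at h2
    linarith
  ext x
  exact le_antisymm (hle p _ hp (extend_ratInclusion μ) x)
    (hle _ p (extend_ratInclusion μ) hp x)

/-- `c₀₀` equipped with the pseudonorm `μ`. -/
def C00 (_ : Pseudonorms) : Type := ℕ →₀ ℝ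

noncomputable instance (μ : Pseudonorms) : AddCommGroup (C00 μ) :=
  inferInstanceAs (AddCommGroup (ℕ →₀ ℝ))

noncomputable instance (μ : Pseudonorms) : Module ℝ (C00 μ) :=
  inferInstanceAs (Module ℝ (ℕ →₀ ℝ))

noncomputable instance (μ : Pseudonorms) : SeminormedAddCommGroup (C00 μ) :=
  AddGroupSeminorm.toSeminormedAddCommGroup (E := C00 μ) (extend μ).toAddGroupSeminorm

noncomputable instance (μ : Pseudonorms) : NormedSpace ℝ (C00 μ) where
  norm_smul_le t x := (map_smul_eq_mul (extend μ) t x).le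

/-- The identity map from `c₀₀` to `(c₀₀, μ)`. -/
noncomputable def toC00 (μ : Pseudonorms) : (ℕ →₀ ℝ) ≃ₗ[ℝ] C00 μ :=
  LinearEquiv.refl ℝ (ℕ →₀ ℝ)

theorem norm_toC00 (μ : Pseudonorms) (x : ℕ →₀ ℝ) : ‖toC00 μ x‖ = extend μ x := rfl

/-- The Banach space `X_μ`: the completion of the quotient of `(c₀₀, μ)` by the kernel of `μ`. -/
abbrev X (μ : Pseudonorms) : Type :=
  UniformSpace.Completion (SeparationQuotient (C00 μ))

/-- The set of `μ` for which `X_μ` is infinite-dimensional; as a type it carries the subspace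
topology. -/
def PInfty : Set Pseudonorms := {μ | ¬ FiniteDimensional ℝ (X μ)}

/-! ### The Szlenk index -/

section Szlenk

universe u

variable {E : Type u} [NormedAddCommGroup E] [NormedSpace ℝ E]

/-- The Szlenk derivative: the points of `F` all of whose weak* neighbourhoods meet `F` in a set
of norm diameter at least `ε`. -/
def szlenkDeriv (ε : ℝ) (F : Set (StrongDual ℝ E)) : Set (StrongDual ℝ E) :=
  {f | f ∈ F ∧ ∀ U : Set (WeakDual ℝ E), IsOpen U → StrongDual.toWeakDual f ∈ U →
    ENNReal.ofReal ε ≤ Metric.ediam (StrongDual.toWeakDual ⁻¹' U ∩ F)}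

/-- The transfinite iterates of the Szlenk derivative, with intersections at limit ordinals. -/
noncomputable def szlenkIter (ε : ℝ) (F : Set (StrongDual ℝ E)) (a : Ordinal.{u}) :
    Set (StrongDual ℝ E) :=
  Ordinal.limitRecOn a F (fun _ S => szlenkDeriv ε S) (fun a _ S => ⋂ b, ⋂ h : b < a, S b h)

theorem szlenkIter_zero (ε : ℝ) (F : Set (StrongDual ℝ E)) : szlenkIter ε F 0 = F := by
  simp [szlenkIter]

theorem szlenkIter_add_one (ε : ℝ) (F : Set (StrongDual ℝ E)) (a : Ordinal.{u}) :
    szlenkIter ε F (a + 1) = szlenkDeriv ε (szlenkIter ε F a) := by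
  simp [szlenkIter]

theorem szlenkIter_limit (ε : ℝ) (F : Set (StrongDual ℝ E)) (a : Ordinal.{u})
    (ha : Order.IsSuccLimit a) : szlenkIter ε F a = ⋂ b < a, szlenkIter ε F b := by
  rw [szlenkIter, Ordinal.limitRecOn_limit _ _ _ _ ha]
  rfl

variable (E)

/-- `Sz(E, ε)`: the least ordinal `a` for which the `a`-th derivative of the closed dual unit ball
is empty; it is `⊤` if there is no such ordinal. -/
noncomputable def szlenkIndexAt (ε : ℝ) : WithTop Ordinal.{u} :=
  sInf ((fun a : Ordinal.{u} => (a : WithTop Ordinal.{u})) ''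
    {a | szlenkIter ε (Metric.closedBall (0 : StrongDual ℝ E) 1) a = ∅})

/-- The Szlenk index `Sz(E) = sup_{ε > 0} Sz(E, ε)`, where `⊤` stands for `∞`. -/
noncomputable def szlenkIndex : WithTop Ordinal.{u} :=
  ⨆ ε : {ε : ℝ // 0 < ε}, szlenkIndexAt E ε

end Szlenk

end BanachCoding

/-! Restriction to `V` identifies the dual ball of `X μ` with the set of additive `g : V → ℝ`
satisfying `|g v| ≤ μ v`, and on weak* closed subsets of the ball the weak* topology becomes
pointwise convergence on `V`. All the balls thus lie in one second countable space `V → ℝ`, where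
different `μ` can be compared.

Write `F a` for the `a`-th Szlenk iterate of the ball. The core claim,
`isSigma_setOf_preimage_szlenkIter_eq_empty`, is that for each closed `C ⊆ ℝ^V` the condition "`C`
misses `F a`" on `μ` is `Σ⁰` of index `2 + 4 * a`. For `a = 0` it is open, by compactness. At a
successor, compactness turns it into the existence of finitely many basic open sets that cover `C ∩
F a` and whose closures cut `F a` in sets of diameter `< ε`; such a diameter bound is again a
countable combination of conditions "a closed set misses `F a`". At a limit, compactness makes the
condition a countable union of earlier ones.

For `a = ω ^ α` with `α ≥ 1` the index `2 + 4 * a` collapses to `ω ^ α`, and intersecting over `ε =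
1 / (n + 1)` gives the class `Π⁰` of index `ω ^ α + 1`. -/

namespace BanachCoding

/-! ### Closure properties of the Borel classes -/

section Borel

variable {T : Type*} [TopologicalSpace T]

theorem isSigma_iff {a : Ordinal.{0}} {A : Set T} : IsSigma a A ↔ (a = 1 ∧ IsOpen A) ∨
    (1 < a ∧ ∃ (B : ℕ → Set T) (b : ℕ → Ordinal.{0}), (∀ n, 1 ≤ b n) ∧ (∀ n, b n < a) ∧
      (∀ n, IsSigma (b n) (B n)ᶜ) ∧ A = ⋃ n, B n) := by
  constructor
  · intro h
    induction h with
    | isOpen U hU => exact .inl ⟨rfl, hU⟩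
    | iUnion a ha B b hb hba hB => exact .inr ⟨ha, B, b, hb, hba, hB, rfl⟩
  · rintro (⟨rfl, hA⟩ | ⟨ha, B, b, hb, hba, hB, rfl⟩)
    · exact .isOpen A hA
    · exact .iUnion a ha B b hb hba hB

theorem IsSigma.one_le {a : Ordinal.{0}} {A : Set T} (h : IsSigma a A) : 1 ≤ a := by
  rcases isSigma_iff.1 h with ⟨rfl, -⟩ | ⟨ha, -⟩
  · exact le_rfl
  · exact ha.le

/-- `Π⁰ₐ`-sets are `Σ⁰_b` for `a < b`. -/
theorem IsSigma.of_compl {a b : Ordinal.{0}} {A : Set T} (h : IsSigma a Aᶜ) (hab : a < b) :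
    IsSigma b A :=
  isSigma_iff.2 <| .inr ⟨h.one_le.trans_lt hab, fun _ => A, fun _ => a, fun _ => h.one_le,
    fun _ => hab, fun _ => h, (iUnion_const A).symm⟩

/-- `Σ⁰ₐ` is closed under unions of sequences. -/
theorem IsSigma.iUnion_nat {a : Ordinal.{0}} {A : ℕ → Set T} (h : ∀ n, IsSigma a (A n)) :
    IsSigma a (⋃ n, A n) := by
  by_cases ha : 1 < a
  · choose B b hb hba hB hA using fun n =>
      ((isSigma_iff.1 (h n)).resolve_left fun h1 => ha.ne' h1.1).2
    have hU : ⋃ n, A n = ⋃ m : ℕ, B m.unpair.1 m.unpair.2 := by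
      rw [Set.iUnion_unpair B]
      exact iUnion_congr hA
    rw [hU]
    exact .iUnion a ha _ (fun m => b m.unpair.1 m.unpair.2) (fun _ => hb _ _)
      (fun _ => hba _ _) fun _ => hB _ _
  · obtain rfl : a = 1 := le_antisymm (not_lt.1 ha) (h 0).one_le
    exact .isOpen _ (isOpen_iUnion fun n =>
      ((isSigma_iff.1 (h n)).resolve_right fun h1 => ha h1.1).2)

variable [TopologicalSpace.PseudoMetrizableSpace T]

/-- Pseudometrizability matters only for `a = 1`, where an open set must be written as an `Fσ`; for
`a > 1` the same decomposition serves for `b`. -/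
theorem IsSigma.mono {a b : Ordinal.{0}} {A : Set T} (h : IsSigma a A) (hab : a ≤ b) :
    IsSigma b A := by
  rcases hab.eq_or_lt with rfl | hab
  · exact h
  rcases isSigma_iff.1 h with ⟨rfl, hA⟩ | ⟨ha, B, c, hc, hca, hB, rfl⟩
  · let := TopologicalSpace.pseudoMetrizableSpacePseudoMetric T
    obtain ⟨f, hf, hAf⟩ := isGδ_iff_eq_iInter_nat.1 hA.isClosed_compl.isGδ
    have hAU : A = ⋃ n, (f n)ᶜ := by rw [← compl_iInter, ← hAf, compl_compl]
    rw [hAU]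
    exact .iUnion b hab _ (fun _ => 1) (fun _ => le_rfl) (fun _ => hab) fun n => by
      simpa using IsSigma.isOpen _ (hf n)
  · exact .iUnion b (ha.trans hab) B c hc (fun n => (hca n).trans hab) hB

theorem IsSigma.iUnion_countable {ι : Sort*} [Countable ι] {a : Ordinal.{0}} (ha : 1 ≤ a)
    {A : ι → Set T} (h : ∀ i, IsSigma a (A i)) : IsSigma a (⋃ i, A i) := by
  rcases isEmpty_or_nonempty ι with hι | hι
  · rw [iUnion_of_empty]
    exact (IsSigma.isOpen _ isOpen_empty).mono ha
  · obtain ⟨f, hf⟩ := exists_surjective_nat ι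
    rw [← hf.iUnion_comp]
    exact .iUnion_nat fun n => h (f n)

theorem IsSigma.union {a : Ordinal.{0}} {A B : Set T} (hA : IsSigma a A) (hB : IsSigma a B) :
    IsSigma a (A ∪ B) := by
  rw [union_eq_iUnion]
  exact .iUnion_countable hA.one_le (Bool.forall_bool.2 ⟨hB, hA⟩)

/-- A countable intersection of `Σ⁰ₐ`-sets is `Π⁰_{a+1}`. -/
theorem IsPi.iInter_isSigma {ι : Sort*} [Countable ι] {a : Ordinal.{0}} (ha : 1 ≤ a)
    {A : ι → Set T} (h : ∀ i, IsSigma a (A i)) : IsPi (a + 1) (⋂ i, A i) := by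
  rw [IsPi, compl_iInter]
  refine .iUnion_countable (ha.trans (Order.le_succ a)) fun i => ?_
  exact .of_compl (a := a) (by simpa using h i) (Order.lt_succ a)

theorem IsSigma.iInter_countable {ι : Sort*} [Countable ι] {a : Ordinal.{0}} (ha : 1 ≤ a)
    {A : ι → Set T} (h : ∀ i, IsSigma a (A i)) : IsSigma (a + 2) (⋂ i, A i) := by
  refine .of_compl (IsPi.iInter_isSigma ha h) ?_
  rw [← one_add_one_eq_two, ← add_assoc]
  exact Order.lt_succ _

end Borel

/-! ### Ordinal arithmetic -/

theorem opow_lt_omega_one {α : Ordinal.{0}} (hα : α < Ordinal.omega 1) :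
    Ordinal.omega0 ^ α < Ordinal.omega 1 :=
  Ordinal.isPrincipal_opow_omega 1 Ordinal.omega0_lt_omega_one hα

theorem countable_Iio_of_lt_omega_one {a : Ordinal.{0}} (ha : a < Ordinal.omega 1) :
    Countable (Iio a) := by
  rw [← Cardinal.mk_le_aleph0_iff, Cardinal.mk_Iio_ordinal, Cardinal.lift_le_aleph0]
  rw [Cardinal.lt_omega_iff_card_lt] at ha
  rwa [← Cardinal.succ_aleph0, Order.lt_succ_iff] at ha

/-- Since `4 * ω = ω`, a left factor `4` is absorbed, and `2 < ω ≤ ω ^ α` is absorbed because `ω ^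
α` is additively principal. Hence any finite cost per derivative would do in the complexity
estimate. -/
theorem two_add_four_mul_opow {α : Ordinal.{0}} (h1 : 1 ≤ α) :
    2 + 4 * Ordinal.omega0 ^ α = Ordinal.omega0 ^ α := by
  have h4 : (4 : Ordinal.{0}) * Ordinal.omega0 ^ α = Ordinal.omega0 ^ α := by
    rw [← Ordinal.add_sub_cancel_of_le h1, Ordinal.opow_add, Ordinal.opow_one, ← mul_assoc]
    congr 1
    exact_mod_cast Ordinal.natCast_mul_omega0 (n := 4) (by norm_num)
  rw [h4]
  refine Ordinal.add_omega0_opow ?_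
  refine lt_of_lt_of_le (Ordinal.natCast_lt_omega0 2) ?_
  simpa using Ordinal.opow_le_opow_right Ordinal.omega0_pos h1

/-! ### Functionals on `X μ` as additive functions on `V` -/

section Functionals

theorem abs_le_mul_weight (μ : Pseudonorms) (r : ℝ) (G : (ℕ →₀ ℝ) →ₗ[ℝ] ℝ)
    (hG : ∀ v, |G (ratInclusion v)| ≤ r * μ v) (x : ℕ →₀ ℝ) : |G x| ≤ r * weight μ x := by
  have hs : ∀ i t, Finsupp.single i t = t • ratInclusion (Finsupp.single i 1) := fun i t => by
    ext j
    rw [Finsupp.smul_apply, ratInclusion_apply, Finsupp.single_apply, Finsupp.single_apply]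
    split_ifs <;> simp
  conv_lhs => rw [← Finsupp.sum_single x, Finsupp.sum, map_sum]
  refine (Finset.abs_sum_le_sum_abs _ _).trans ?_
  rw [weight, Finsupp.sum, Finset.mul_sum]
  refine Finset.sum_le_sum fun i _ => ?_
  rw [hs, map_smul, smul_eq_mul, abs_mul, mul_left_comm]
  exact mul_le_mul_of_nonneg_left (hG _) (abs_nonneg _)

/-- A linear functional on `c₀₀` which is dominated by `r * μ` on `V` is dominated on `c₀₀`. -/
theorem abs_le_mul_extend (μ : Pseudonorms) {r : ℝ} (hr : 0 ≤ r) (G : (ℕ →₀ ℝ) →ₗ[ℝ] ℝ)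
    (hG : ∀ v, |G (ratInclusion v)| ≤ r * μ v) (x : ℕ →₀ ℝ) : |G x| ≤ r * extend μ x := by
  change |G x| ≤ r * ⨅ v : V, (μ v + weight μ (x - ratInclusion v))
  rw [Real.mul_iInf_of_nonneg hr]
  refine le_ciInf fun v => ?_
  have h1 := abs_le_mul_weight μ r G hG (x - ratInclusion v)
  have h2 := abs_add_le (G (ratInclusion v)) (G (x - ratInclusion v))
  rw [← map_add, add_sub_cancel] at h2
  linarith [hG v]

/-- The canonical map of `c₀₀` into `X_μ`. -/
noncomputable def c00ToX (μ : Pseudonorms) : (ℕ →₀ ℝ) →ₗ[ℝ] X μ where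
  toFun x := ((SeparationQuotient.mk (toC00 μ x) : SeparationQuotient (C00 μ)) : X μ)
  map_add' x y := by
    rw [map_add, SeparationQuotient.mk_add, UniformSpace.Completion.coe_add]
  map_smul' t x := by
    rw [map_smul, SeparationQuotient.mk_smul, UniformSpace.Completion.coe_smul]; rfl

theorem norm_c00ToX (μ : Pseudonorms) (x : ℕ →₀ ℝ) : ‖c00ToX μ x‖ = extend μ x := by
  change ‖((SeparationQuotient.mk (toC00 μ x) : SeparationQuotient (C00 μ)) : X μ)‖ = _
  rw [UniformSpace.Completion.norm_coe, SeparationQuotient.norm_mk, norm_toC00]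

theorem denseRange_c00ToX (μ : Pseudonorms) : DenseRange (c00ToX μ) :=
  (UniformSpace.Completion.denseRange_coe (α := SeparationQuotient (C00 μ))).comp
    (SeparationQuotient.surjective_mk.comp (toC00 μ).surjective).denseRange
    (UniformSpace.Completion.continuous_coe _)

/-- The canonical map of `V` into `X_μ`. -/
noncomputable def ratToX (μ : Pseudonorms) : V →+ X μ :=
  (c00ToX μ).toAddMonoidHom.comp ratInclusion

theorem norm_ratToX (μ : Pseudonorms) (v : V) : ‖ratToX μ v‖ = μ v :=
  (norm_c00ToX μ _).trans (extend_ratInclusion μ v)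

/-- The restriction of a functional on `X_μ` to `V`. -/
noncomputable def restrictV (μ : Pseudonorms) (f : StrongDual ℝ (X μ)) : V → ℝ :=
  fun v => f (ratToX μ v)

theorem restrictV_sub (μ : Pseudonorms) (f g : StrongDual ℝ (X μ)) :
    restrictV μ (f - g) = restrictV μ f - restrictV μ g := rfl

/-- A bound on `V` passes to `c₀₀` by `abs_le_mul_extend` and to `X μ` by density, so dual norms are
governed by countably many inequalities. -/
theorem norm_le_iff_restrictV (μ : Pseudonorms) {r : ℝ} (hr : 0 ≤ r) (f : StrongDual ℝ (X μ)) :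
    ‖f‖ ≤ r ↔ ∀ v, |restrictV μ f v| ≤ r * μ v := by
  refine ⟨fun h v => ?_, fun h => ?_⟩
  · rw [← norm_ratToX, ← Real.norm_eq_abs]
    exact f.le_of_opNorm_le h _
  · refine f.opNorm_le_bound hr fun x => ?_
    refine (denseRange_c00ToX μ).induction_on (p := fun x => ‖f x‖ ≤ r * ‖x‖) x
      (isClosed_le (by fun_prop) (by fun_prop)) fun y => ?_
    rw [norm_c00ToX]
    exact abs_le_mul_extend μ hr (f.toLinearMap ∘ₗ c00ToX μ) h y

theorem restrictV_injective (μ : Pseudonorms) : Function.Injective (restrictV μ) := by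
  intro f g h
  refine sub_eq_zero.1 (norm_le_zero_iff.1 ((norm_le_iff_restrictV μ le_rfl _).2 fun v => ?_))
  rw [restrictV_sub, h, sub_self]
  simp

/-- Additivity already gives `ℚ`-linearity, so `g` is determined by its values at the unit vectors.
The real-linear functional with these values is dominated by `extend μ` and extends to the
completion. -/
theorem exists_restrictV_eq (μ : Pseudonorms) (g : V → ℝ) (hadd : ∀ v w, g (v + w) = g v + g w)
    (hg : ∀ v, |g v| ≤ μ v) : ∃ f : StrongDual ℝ (X μ), ‖f‖ ≤ 1 ∧ restrictV μ f = g := by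
  let g' : V →+ ℝ := AddMonoidHom.mk' g hadd
  let G : (ℕ →₀ ℝ) →ₗ[ℝ] ℝ := Finsupp.linearCombination ℝ fun i => g (Finsupp.single i 1)
  have hG : ∀ v, G (ratInclusion v) = g v := fun v => by
    have : G.toAddMonoidHom.comp ratInclusion = g' := by
      ext i q
      · have h : ratInclusion (Finsupp.single i q) = Finsupp.single i (q : ℝ) := by
          simp [ratInclusion]
        have h' : (Finsupp.single i q : V) = q • Finsupp.single i 1 := by simp
        have h2 : g' (q • Finsupp.single i 1) = q • g' (Finsupp.single i 1) :=
          map_rat_smul g' q _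
        change G (ratInclusion (Finsupp.single i q)) = g' (Finsupp.single i q)
        rw [h, h', h2, Finsupp.linearCombination_single, Rat.smul_def]
        rfl
    exact DFunLike.congr_fun this v
  have hb : ∀ x, ‖G x‖ ≤ 1 * ‖c00ToX μ x‖ := fun x => by
    rw [norm_c00ToX]
    exact abs_le_mul_extend μ zero_le_one G (fun v => by rw [hG, one_mul]; exact hg v) x
  have heq : restrictV μ (G.extendOfNorm (c00ToX μ)) = g := by
    funext v
    exact (LinearMap.extendOfNorm_eq (denseRange_c00ToX μ) ⟨1, hb⟩ _).trans (hG v)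
  refine ⟨G.extendOfNorm (c00ToX μ), ?_, heq⟩
  rw [norm_le_iff_restrictV μ zero_le_one, heq]
  simpa using hg

end Functionals

/-! ### Monotonicity and weak* closedness of Szlenk iterates -/

section SzlenkGeneral

universe u

variable {E : Type u} [NormedAddCommGroup E] [NormedSpace ℝ E]

theorem szlenkDeriv_subset (ε : ℝ) (F : Set (StrongDual ℝ E)) : szlenkDeriv ε F ⊆ F :=
  fun _ hf => hf.1

theorem szlenkDeriv_mono {ε δ : ℝ} (h : ε ≤ δ) {F G : Set (StrongDual ℝ E)} (hFG : F ⊆ G) :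
    szlenkDeriv δ F ⊆ szlenkDeriv ε G := fun _ hf =>
  ⟨hFG hf.1, fun U hU hfU => (ENNReal.ofReal_le_ofReal h).trans <| (hf.2 U hU hfU).trans <|
    Metric.ediam_mono (inter_subset_inter_right _ hFG)⟩

theorem szlenkIter_antitone (ε : ℝ) (F : Set (StrongDual ℝ E)) :
    Antitone (szlenkIter ε F) := by
  intro a b
  induction b using Ordinal.limitRecOn with
  | zero =>
    intro hab
    rw [nonpos_iff_eq_zero.1 hab]
  | add_one b ih =>
    intro hab
    rcases hab.eq_or_lt with rfl | hab
    · exact le_rfl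
    · rw [szlenkIter_add_one]
      exact (szlenkDeriv_subset _ _).trans (ih (Order.lt_add_one_iff.1 hab))
  | limit b hb ih =>
    intro hab
    rcases hab.eq_or_lt with rfl | hab
    · exact le_rfl
    · rw [szlenkIter_limit _ _ _ hb]
      exact iInter₂_subset a hab

theorem szlenkIter_subset (ε : ℝ) (F : Set (StrongDual ℝ E)) (a : Ordinal.{u}) :
    szlenkIter ε F a ⊆ F := by
  simpa [szlenkIter_zero] using szlenkIter_antitone ε F (zero_le (a := a))

theorem szlenkIter_anti_eps {ε δ : ℝ} (h : ε ≤ δ) (F : Set (StrongDual ℝ E)) (a : Ordinal.{u}) :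
    szlenkIter δ F a ⊆ szlenkIter ε F a := by
  induction a using Ordinal.limitRecOn with
  | zero => simp [szlenkIter_zero]
  | add_one a ih =>
    rw [szlenkIter_add_one, szlenkIter_add_one]
    exact szlenkDeriv_mono h ih
  | limit a ha ih =>
    rw [szlenkIter_limit _ _ _ ha, szlenkIter_limit _ _ _ ha]
    exact iInter₂_mono ih

theorem isClosed_szlenkDeriv (ε : ℝ) {F : Set (StrongDual ℝ E)}
    (hF : IsClosed (WeakDual.toStrongDual ⁻¹' F)) :
    IsClosed (WeakDual.toStrongDual ⁻¹' szlenkDeriv ε F) := by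
  -- The derivative removes from `F` the union of all weak* open sets with a small slice.
  have h : WeakDual.toStrongDual ⁻¹' szlenkDeriv ε F = WeakDual.toStrongDual ⁻¹' F ∩
      ⋂ (U : Set (WeakDual ℝ E)) (_ : IsOpen U ∧
        ¬ ENNReal.ofReal ε ≤ Metric.ediam (StrongDual.toWeakDual ⁻¹' U ∩ F)), Uᶜ := by
    ext f
    simp only [mem_inter_iff, mem_preimage, mem_iInter, mem_compl_iff]
    refine and_congr_right fun _ => forall_congr' fun U => ?_
    rw [WeakDual.toWeakDual_toStrongDual]
    tauto
  rw [h]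
  exact hF.inter (isClosed_iInter fun U => isClosed_iInter fun hU => hU.1.isClosed_compl)

theorem isClosed_szlenkIter (ε : ℝ) {F : Set (StrongDual ℝ E)}
    (hF : IsClosed (WeakDual.toStrongDual ⁻¹' F)) (a : Ordinal.{u}) :
    IsClosed (WeakDual.toStrongDual ⁻¹' szlenkIter ε F a) := by
  induction a using Ordinal.limitRecOn with
  | zero => rwa [szlenkIter_zero]
  | add_one a ih =>
    rw [szlenkIter_add_one]
    exact isClosed_szlenkDeriv ε ih
  | limit a ha ih =>
    rw [szlenkIter_limit _ _ _ ha]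
    simp only [preimage_iInter]
    exact isClosed_biInter ih

theorem szlenkIndexAt_le_iff (ε : ℝ) (a : Ordinal.{u}) : szlenkIndexAt E ε ≤ a ↔
    szlenkIter ε (Metric.closedBall (0 : StrongDual ℝ E) 1) a = ∅ := by
  refine ⟨fun h => ?_, fun h => csInf_le' ⟨a, h, rfl⟩⟩
  rcases eq_empty_or_nonempty ((fun a : Ordinal.{u} => (a : WithTop Ordinal.{u})) ''
    {a | szlenkIter ε (Metric.closedBall (0 : StrongDual ℝ E) 1) a = ∅}) with h0 | h0
  · rw [szlenkIndexAt, h0, WithTop.sInf_empty] at h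
    exact absurd h (by simp)
  · obtain ⟨b, hb, hba⟩ := csInf_mem h0
    rw [szlenkIndexAt, ← hba, WithTop.coe_le_coe] at h
    exact subset_empty_iff.1 ((szlenkIter_antitone _ _ h).trans (subset_empty_iff.2 hb))

theorem szlenkIndex_le_iff (a : Ordinal.{u}) : szlenkIndex E ≤ a ↔
    ∀ n : ℕ, szlenkIter (1 / (n + 1)) (Metric.closedBall (0 : StrongDual ℝ E) 1) a = ∅ := by
  rw [szlenkIndex, iSup_le_iff]
  simp only [szlenkIndexAt_le_iff, Subtype.forall]
  refine ⟨fun h n => h _ Nat.one_div_pos_of_nat, fun h ε hε => ?_⟩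
  obtain ⟨n, hn⟩ := exists_nat_one_div_lt hε
  exact subset_empty_iff.1 ((szlenkIter_anti_eps hn.le _ _).trans (h n).subset)

end SzlenkGeneral

/-! ### Szlenk derivatives in terms of closed subsets of `ℝ^V` -/

section SzlenkCoding

variable (μ : Pseudonorms)

theorem continuous_restrictV :
    Continuous fun f : WeakDual ℝ (X μ) => restrictV μ (WeakDual.toStrongDual f) :=
  continuous_pi fun v => WeakDual.eval_continuous (ratToX μ v)

variable {μ}

theorem isCompact_of_isClosed_of_subset {F : Set (StrongDual ℝ (X μ))}
    (hF : IsClosed (WeakDual.toStrongDual ⁻¹' F)) (hFB : F ⊆ Metric.closedBall 0 1) :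
    IsCompact (WeakDual.toStrongDual ⁻¹' F) :=
  (WeakDual.isCompact_closedBall 0 1).of_isClosed_subset hF (preimage_mono hFB)

/-- On weak* compact sets, the weak* topology is that of pointwise convergence on `V`. -/
theorem exists_isOpen_restrictV {F : Set (StrongDual ℝ (X μ))}
    (hF : IsClosed (WeakDual.toStrongDual ⁻¹' F)) (hFB : F ⊆ Metric.closedBall 0 1)
    {U : Set (WeakDual ℝ (X μ))} (hU : IsOpen U) {f : StrongDual ℝ (X μ)}
    (hf : StrongDual.toWeakDual f ∈ U) :
    ∃ W : Set (V → ℝ), IsOpen W ∧ restrictV μ f ∈ W ∧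
      restrictV μ ⁻¹' W ∩ F ⊆ StrongDual.toWeakDual ⁻¹' U := by
  have hK : IsCompact (WeakDual.toStrongDual ⁻¹' F \ U) :=
    (isCompact_of_isClosed_of_subset hF hFB).diff hU
  -- `W` is the complement of the compact image of `F \ U`; it contains the image of `f` because
  -- restriction is injective.
  refine ⟨((fun f => restrictV μ (WeakDual.toStrongDual f)) '' (WeakDual.toStrongDual ⁻¹' F \ U))ᶜ,
    (hK.image (continuous_restrictV μ)).isClosed.isOpen_compl, ?_, ?_⟩
  · rintro ⟨g, hg, hgf⟩
    have := restrictV_injective μ hgf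
    rw [← this, WeakDual.toWeakDual_toStrongDual] at hf
    exact hg.2 hf
  · rintro g ⟨hg, hgF⟩
    by_contra hgU
    exact hg ⟨StrongDual.toWeakDual g, ⟨by simpa using hgF, hgU⟩, by simp⟩

open TopologicalSpace in
-- A point of `C ∩ F` outside the derivative has a basic neighbourhood with a small slice, and
-- finitely many of these cover the compact set `C ∩ F`. Regularity of `V → ℝ` allows closures in
-- the diameter condition, so that only closed sets occur and the induction hypothesis on `F`
-- applies.
theorem preimage_inter_szlenkDeriv_eq_empty_iff {ε : ℝ} {F : Set (StrongDual ℝ (X μ))}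
    (hF : IsClosed (WeakDual.toStrongDual ⁻¹' F)) (hFB : F ⊆ Metric.closedBall 0 1)
    {C : Set (V → ℝ)} (hC : IsClosed C) :
    restrictV μ ⁻¹' C ∩ szlenkDeriv ε F = ∅ ↔ ∃ s : Finset (countableBasis (V → ℝ)),
      (∀ b ∈ s, Metric.ediam (restrictV μ ⁻¹' closure b.1 ∩ F) < ENNReal.ofReal ε) ∧
        restrictV μ ⁻¹' (C ∩ ⋂ b ∈ s, b.1ᶜ) ∩ F = ∅ := by
  constructor
  · intro h
    have hK : IsCompact (WeakDual.toStrongDual ⁻¹' (restrictV μ ⁻¹' C ∩ F)) :=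
      isCompact_of_isClosed_of_subset ((hC.preimage (continuous_restrictV μ)).inter hF)
        (inter_subset_right.trans hFB)
    obtain ⟨s, hs⟩ := hK.elim_finite_subfamily_closed
      (fun b : {b : countableBasis (V → ℝ) //
        Metric.ediam (restrictV μ ⁻¹' closure b.1 ∩ F) < ENNReal.ofReal ε} =>
        (fun f => restrictV μ (WeakDual.toStrongDual f)) ⁻¹' b.1.1ᶜ)
      (fun b => (isOpen_of_mem_countableBasis b.1.2).isClosed_compl.preimage
        (continuous_restrictV μ)) (by
        refine eq_empty_of_forall_notMem fun f hf => ?_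
        have hfs : WeakDual.toStrongDual f ∉ szlenkDeriv ε F := fun h' =>
          (h ▸ ⟨hf.1.1, h'⟩ : WeakDual.toStrongDual f ∈ (∅ : Set (StrongDual ℝ (X μ))))
        simp only [szlenkDeriv, mem_ofPred_eq, not_and, not_forall, not_le] at hfs
        obtain ⟨U, hU, hfU, hUd⟩ := hfs hf.1.2
        obtain ⟨W, hW, hfW, hWU⟩ := exists_isOpen_restrictV hF hFB hU hfU
        obtain ⟨b, hb, hfb, hbW⟩ := (isBasis_countableBasis (V → ℝ)).exists_closure_subset
          (hW.mem_nhds hfW)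
        refine mem_iInter.1 hf.2 ⟨⟨b, hb⟩, ?_⟩ hfb
        have hsub : restrictV μ ⁻¹' closure b ∩ F ⊆ StrongDual.toWeakDual ⁻¹' U ∩ F :=
          fun g hg => ⟨hWU ⟨hbW hg.1, hg.2⟩, hg.2⟩
        exact (Metric.ediam_mono hsub).trans_lt hUd)
    classical
    refine ⟨s.image Subtype.val, ?_, ?_⟩
    · intro b hb
      obtain ⟨c, -, rfl⟩ := Finset.mem_image.1 hb
      exact c.2
    · refine eq_empty_of_forall_notMem fun f hf => ?_
      refine (hs ▸ ⟨⟨by simpa using hf.1.1, by simpa using hf.2⟩, ?_⟩ :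
        StrongDual.toWeakDual f ∈ (∅ : Set (WeakDual ℝ (X μ))))
      simp only [mem_iInter]
      intro b hb
      exact mem_iInter₂.1 hf.1.2 b.1 (Finset.mem_image_of_mem _ hb)
  · rintro ⟨s, hs, hsF⟩
    refine eq_empty_of_forall_notMem fun f hf => ?_
    by_cases hfs : ∃ b ∈ s, restrictV μ f ∈ b.1
    · obtain ⟨b, hb, hfb⟩ := hfs
      have h1 := hf.2.2 _ ((isOpen_of_mem_countableBasis b.2).preimage (continuous_restrictV μ))
        (by simpa using hfb)
      refine (h1.trans (Metric.ediam_mono ?_)).not_gt (hs b hb)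
      intro g hg
      exact ⟨subset_closure (by simpa using hg.1), hg.2⟩
    · push Not at hfs
      exact (hsF ▸ ⟨⟨hf.1, mem_iInter₂.2 hfs⟩, hf.2.1⟩ : f ∈ (∅ : Set (StrongDual ℝ (X μ))))

/-- Diameter `< ε` means that some rational `r < ε` satisfies `f v - g v ≤ r * μ v` for all `f`, `g`
in the slice. A violation is witnessed by rationals `a ≤ f v` and `b ≥ g v` with `a - b > r * μ v`,
which leaves countably many conditions, each an inequality on `μ` or the emptiness of a closed
slice. -/
theorem ediam_preimage_inter_lt_iff {ε : ℝ} (hε : 0 < ε) (F : Set (StrongDual ℝ (X μ)))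
    (G : Set (V → ℝ)) :
    Metric.ediam (restrictV μ ⁻¹' G ∩ F) < ENNReal.ofReal ε ↔
      ∃ r : {r : ℚ // 0 ≤ r ∧ (r : ℝ) < ε}, ∀ (v : V) (a b : ℚ), (a - b : ℝ) ≤ r.1 * μ v ∨
        restrictV μ ⁻¹' (G ∩ {x | (a : ℝ) ≤ x v}) ∩ F = ∅ ∨
        restrictV μ ⁻¹' (G ∩ {x | x v ≤ b}) ∩ F = ∅ := by
  constructor
  · intro h
    have hfin : Metric.ediam (restrictV μ ⁻¹' G ∩ F) ≠ ⊤ := h.ne_top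
    rw [← ENNReal.ofReal_toReal hfin, ENNReal.ofReal_lt_ofReal_iff hε] at h
    obtain ⟨r, hr1, hr2⟩ := exists_rat_btwn h
    have hr0 : (0 : ℝ) ≤ r := ENNReal.toReal_nonneg.trans hr1.le
    refine ⟨⟨r, by exact_mod_cast hr0, hr2⟩, fun v a b => ?_⟩
    by_contra! hcon
    obtain ⟨h1, ⟨f, hf⟩, ⟨g, hg⟩⟩ := hcon
    have hd : ‖f - g‖ ≤ r := by
      refine (dist_eq_norm f g).symm.trans_le (le_trans ?_ hr1.le)
      rw [dist_edist]
      exact ENNReal.toReal_mono hfin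
        (Metric.edist_le_ediam_of_mem ⟨hf.1.1, hf.2⟩ ⟨hg.1.1, hg.2⟩)
    have h2 := (le_abs_self _).trans ((norm_le_iff_restrictV μ hr0 _).1 hd v)
    rw [restrictV_sub, Pi.sub_apply] at h2
    have h3 : (a : ℝ) ≤ restrictV μ f v := hf.1.2
    have h4 : restrictV μ g v ≤ b := hg.1.2
    simp only at h1
    linarith
  · rintro ⟨⟨r, hr0, hrε⟩, h⟩
    refine lt_of_le_of_lt ?_ ((ENNReal.ofReal_lt_ofReal_iff hε).2 hrε)
    have hr0' : (0 : ℝ) ≤ r := by exact_mod_cast hr0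
    have key : ∀ f ∈ restrictV μ ⁻¹' G ∩ F, ∀ g ∈ restrictV μ ⁻¹' G ∩ F, ∀ v,
        restrictV μ f v - restrictV μ g v ≤ r * μ v := by
      intro f hf g hg v
      by_contra! hlt
      obtain ⟨a, ha1, ha2⟩ := exists_rat_btwn (show r * μ v + restrictV μ g v <
        restrictV μ f v by linarith)
      obtain ⟨b, hb1, hb2⟩ := exists_rat_btwn (show restrictV μ g v < a - r * μ v by linarith)
      rcases h v a b with h1 | h1 | h1
      · simp only at h1
        linarith
      · exact (h1 ▸ ⟨⟨hf.1, ha2.le⟩, hf.2⟩ : f ∈ (∅ : Set (StrongDual ℝ (X μ))))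
      · exact (h1 ▸ ⟨⟨hg.1, hb1.le⟩, hg.2⟩ : g ∈ (∅ : Set (StrongDual ℝ (X μ))))
    refine Metric.ediam_le fun f hf g hg => ?_
    rw [edist_dist, dist_eq_norm]
    refine ENNReal.ofReal_le_ofReal ((norm_le_iff_restrictV μ hr0' _).2 fun v => ?_)
    rw [restrictV_sub, Pi.sub_apply, abs_le]
    exact ⟨by linarith [key g hg f hf v], key f hf g hg v⟩

end SzlenkCoding

/-! ### Borel complexity in `μ` -/

section Complexity

open Topology Filter

theorem isInducing_pseudonorms :
    IsInducing (fun (μ : Pseudonorms) (v : V) => μ v) := ⟨rfl⟩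

instance : TopologicalSpace.PseudoMetrizableSpace Pseudonorms :=
  isInducing_pseudonorms.pseudoMetrizableSpace

theorem continuous_apply_pseudonorms (v : V) : Continuous fun μ : Pseudonorms => μ v :=
  (continuous_apply v).comp isInducing_pseudonorms.continuous

/-- The complement is a projection along locally bounded fibres: as `ν → μ`, the witnesses satisfy
`|g ν v| ≤ ν v`, hence stay bounded at each `v`, and an ultrafilter limit of them is a witness for
`μ`. -/
theorem isOpen_setOf_preimage_closedBall_eq_empty {C : Set (V → ℝ)} (hC : IsClosed C) :
    IsOpen {μ : Pseudonorms |
      restrictV μ ⁻¹' C ∩ Metric.closedBall (0 : StrongDual ℝ (X μ)) 1 = ∅} := by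
  have hset : {μ : Pseudonorms |
      restrictV μ ⁻¹' C ∩ Metric.closedBall (0 : StrongDual ℝ (X μ)) 1 = ∅}ᶜ =
      {μ | ∃ g ∈ C, (∀ v w, g (v + w) = g v + g w) ∧ ∀ v, |g v| ≤ μ v} := by
    ext μ
    rw [mem_compl_iff, mem_ofPred_eq, ← ne_eq, ← nonempty_iff_ne_empty]
    constructor
    · rintro ⟨f, hfC, hf⟩
      refine ⟨restrictV μ f, hfC, fun v w => by simp [restrictV], ?_⟩
      simpa using (norm_le_iff_restrictV μ zero_le_one f).1 ((dist_zero_right f).symm.trans_le hf)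
    · rintro ⟨g, hgC, hadd, hg⟩
      obtain ⟨f, hf, rfl⟩ := exists_restrictV_eq μ g hadd hg
      exact ⟨f, hgC, (dist_zero_right f).trans_le hf⟩
  rw [← isClosed_compl_iff, hset, isClosed_iff_ultrafilter]
  intro μ u hu hmem
  choose! g hgC hadd hg using fun (ν : Pseudonorms)
    (h : ∃ g ∈ C, (∀ v w, g (v + w) = g v + g w) ∧ ∀ v, |g v| ≤ ν v) => h
  have hlim : ∀ v, Tendsto (fun ν : Pseudonorms => ν v) u (𝓝 (μ v)) := fun v =>
    ((continuous_apply_pseudonorms v).tendsto μ).mono_left hu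
  have hcpt : ∀ v, ∃ t, Tendsto (fun ν => g ν v) u (𝓝 t) := fun v => by
    -- The slack `1` makes the interval independent of `ν`, since `ν v < μ v + 1` eventually.
    have hev : ∀ᶠ ν in (u : Filter Pseudonorms), g ν v ∈ Icc (-(μ v + 1)) (μ v + 1) := by
      filter_upwards [hmem, (hlim v).eventually_lt_const (lt_add_one (μ v))] with ν h1 h2
      exact abs_le.1 ((hg ν h1 v).trans h2.le)
    obtain ⟨t, -, ht⟩ := (isCompact_Icc (a := -(μ v + 1)) (b := μ v + 1)).ultrafilter_le_nhds
      (u.map fun ν => g ν v) (le_principal_iff.2 hev)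
    exact ⟨t, ht⟩
  choose t ht using hcpt
  have htend : Tendsto g u (𝓝 t) := tendsto_pi_nhds.2 ht
  refine ⟨t, hC.mem_of_tendsto htend (mem_of_superset hmem fun ν h => hgC ν h), fun v w => ?_,
    fun v => ?_⟩
  · refine tendsto_nhds_unique (ht (v + w)) (((ht v).add (ht w)).congr' ?_)
    exact mem_of_superset hmem fun ν h => (hadd ν h v w).symm
  · exact le_of_tendsto_of_tendsto (ht v).abs (hlim v)
      (mem_of_superset hmem fun ν h => hg ν h v)

theorem isSigma_setOf_ediam_lt {c : Ordinal.{0}} (hc : 2 ≤ c) {ε : ℝ} (hε : 0 < ε)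
    (F : ∀ μ : PInfty, Set (StrongDual ℝ (X μ)))
    (hF : ∀ C : Set (V → ℝ), IsClosed C →
      IsSigma c {μ : PInfty | restrictV μ ⁻¹' C ∩ F μ = ∅})
    {G : Set (V → ℝ)} (hG : IsClosed G) :
    IsSigma (c + 2)
      {μ : PInfty | Metric.ediam (restrictV μ ⁻¹' G ∩ F μ) < ENNReal.ofReal ε} := by
  have hc1 : 1 ≤ c := one_le_two.trans hc
  simp only [ediam_preimage_inter_lt_iff hε, ofPred_exists, ofPred_forall]
  refine .iUnion_countable (hc1.trans le_self_add) fun r => ?_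
  have h3 : ⋂ (v : V) (a : ℚ) (b : ℚ), {μ : PInfty | (a - b : ℝ) ≤ r.1 * μ.1 v ∨
        restrictV μ ⁻¹' (G ∩ {x | (a : ℝ) ≤ x v}) ∩ F μ = ∅ ∨
        restrictV μ ⁻¹' (G ∩ {x | x v ≤ b}) ∩ F μ = ∅} =
      ⋂ p : V × ℚ × ℚ, {μ : PInfty | (p.2.1 - p.2.2 : ℝ) ≤ r.1 * μ.1 p.1} ∪
        ({μ : PInfty | restrictV μ ⁻¹' (G ∩ {x | (p.2.1 : ℝ) ≤ x p.1}) ∩ F μ = ∅} ∪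
        {μ : PInfty | restrictV μ ⁻¹' (G ∩ {x | x p.1 ≤ p.2.2}) ∩ F μ = ∅}) := by
    ext μ
    simp only [mem_iInter, Prod.forall, mem_union, mem_ofPred_eq]
  rw [h3]
  refine .iInter_countable hc1 fun p => .union ?_ (.union (hF _ ?_) (hF _ ?_))
  · refine .of_compl (a := 1) (.isOpen _ (IsClosed.isOpen_compl (self := isClosed_le ?_ ?_)))
      (lt_of_lt_of_le one_lt_two hc)
    · exact continuous_const
    · exact continuous_const.mul ((continuous_apply_pseudonorms p.1).comp continuous_subtype_val)
  · exact hG.inter (isClosed_le continuous_const (continuous_apply _))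
  · exact hG.inter (isClosed_le (continuous_apply _) continuous_const)

theorem isClosed_closedBall_weakDual (μ : Pseudonorms) :
    IsClosed (WeakDual.toStrongDual ⁻¹' Metric.closedBall (0 : StrongDual ℝ (X μ)) 1) :=
  WeakDual.isClosed_closedBall 0 1

open TopologicalSpace in
-- All closed `C` are treated at once because the successor step applies the induction hypothesis to
-- smaller closed sets. Each derivative costs `4`: `2` for the diameter conditions and `2` for
-- intersecting them.
theorem isSigma_setOf_preimage_szlenkIter_eq_empty {ε : ℝ} (hε : 0 < ε) (a : Ordinal.{0})
    (ha : a < Ordinal.omega 1) {C : Set (V → ℝ)} (hC : IsClosed C) :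
    IsSigma (2 + 4 * a) {μ : PInfty | restrictV μ ⁻¹' C ∩
      szlenkIter ε (Metric.closedBall (0 : StrongDual ℝ (X μ)) 1) a = ∅} := by
  have h2 : ∀ a : Ordinal.{0}, 2 ≤ 2 + 4 * a := fun a => le_self_add
  induction a using Ordinal.limitRecOn generalizing C with
  | zero =>
    simp only [szlenkIter_zero]
    exact (IsSigma.isOpen _ ((isOpen_setOf_preimage_closedBall_eq_empty hC).preimage
      continuous_subtype_val)).mono (one_le_two.trans (h2 0))
  | add_one a ih =>
    have hlt : a < Ordinal.omega 1 := (Order.lt_add_one_iff.2 le_rfl).trans ha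
    have hc : 2 + 4 * (a + 1) = 2 + 4 * a + 2 + 2 := by
      rw [mul_add_one, ← add_assoc, add_assoc _ 2 2]
      congr 1
      norm_num
    have h1 : (1 : Ordinal.{0}) ≤ 2 + 4 * a + 2 := one_le_two.trans ((h2 a).trans le_self_add)
    rw [hc]
    simp only [szlenkIter_add_one, preimage_inter_szlenkDeriv_eq_empty_iff
      (isClosed_szlenkIter ε (isClosed_closedBall_weakDual _) a) (szlenkIter_subset _ _ _) hC,
      ofPred_exists]
    refine .iUnion_countable (h1.trans le_self_add) fun s => ?_
    -- `none` indexes the covering condition and `some b` the diameter condition for `b`, so one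
    -- countable intersection handles both.
    have hs : {μ : PInfty | (∀ b ∈ s, Metric.ediam (restrictV μ ⁻¹' closure b.1 ∩
          szlenkIter ε (Metric.closedBall (0 : StrongDual ℝ (X μ)) 1) a) < ENNReal.ofReal ε) ∧
        restrictV μ ⁻¹' (C ∩ ⋂ b ∈ s, b.1ᶜ) ∩
          szlenkIter ε (Metric.closedBall (0 : StrongDual ℝ (X μ)) 1) a = ∅} =
      ⋂ o : Option s, o.elim {μ : PInfty | restrictV μ ⁻¹' (C ∩ ⋂ b ∈ s, b.1ᶜ) ∩
          szlenkIter ε (Metric.closedBall (0 : StrongDual ℝ (X μ)) 1) a = ∅}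
        fun b => {μ : PInfty | Metric.ediam (restrictV μ ⁻¹' closure b.1.1 ∩
          szlenkIter ε (Metric.closedBall (0 : StrongDual ℝ (X μ)) 1) a) < ENNReal.ofReal ε} := by
      ext μ
      simp only [mem_iInter, Option.forall, Option.elim, mem_ofPred_eq, Subtype.forall]
      tauto
    rw [hs]
    refine .iInter_countable h1 (Option.rec ?_ fun b => ?_)
    · refine (ih hlt (hC.inter (isClosed_biInter fun b _ => ?_))).mono le_self_add
      exact (isOpen_of_mem_countableBasis b.2).isClosed_compl
    · exact isSigma_setOf_ediam_lt (h2 a) hε _ (fun C hC => ih hlt hC) isClosed_closure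
  | limit a hlim ih =>
    have : Countable (Iio a) := countable_Iio_of_lt_omega_one ha
    have : Nonempty (Iio a) := ⟨⟨0, hlim.bot_lt⟩⟩
    have hset : {μ : PInfty | restrictV μ ⁻¹' C ∩
          szlenkIter ε (Metric.closedBall (0 : StrongDual ℝ (X μ)) 1) a = ∅} =
        ⋃ b : Iio a, {μ : PInfty | restrictV μ ⁻¹' C ∩
          szlenkIter ε (Metric.closedBall (0 : StrongDual ℝ (X μ)) 1) b = ∅} := by
      ext μ
      simp only [mem_iUnion, mem_ofPred_eq]
      constructor
      · intro h
        rw [szlenkIter_limit _ _ _ hlim] at h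
        have hcl := isClosed_closedBall_weakDual (μ : Pseudonorms)
        have hK : IsCompact (WeakDual.toStrongDual ⁻¹'
            (restrictV μ ⁻¹' C ∩ Metric.closedBall (0 : StrongDual ℝ (X μ)) 1)) :=
          isCompact_of_isClosed_of_subset ((hC.preimage (continuous_restrictV _)).inter hcl)
            inter_subset_right
        -- The iterates form a decreasing family of closed sets, so if their intersection misses the
        -- compact set, one of them already does.
        obtain ⟨b, hb⟩ := hK.elim_directed_family_closed
          (fun b : Iio a => WeakDual.toStrongDual ⁻¹'
            szlenkIter ε (Metric.closedBall (0 : StrongDual ℝ (X μ)) 1) b)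
          (fun b => isClosed_szlenkIter ε hcl b) (by
            refine eq_empty_of_forall_notMem fun f hf => ?_
            refine (h ▸ ⟨hf.1.1, mem_iInter₂.2 fun b hb => mem_iInter.1 hf.2 ⟨b, hb⟩⟩ :
              WeakDual.toStrongDual f ∈ (∅ : Set (StrongDual ℝ (X μ)))))
          (Antitone.directed_ge fun b c hbc => preimage_mono (szlenkIter_antitone _ _ hbc))
        refine ⟨b, eq_empty_of_forall_notMem fun f hf => ?_⟩
        exact (hb ▸ ⟨⟨hf.1, szlenkIter_subset _ _ _ hf.2⟩, hf.2⟩ :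
          StrongDual.toWeakDual f ∈ (∅ : Set (WeakDual ℝ (X μ))))
      · rintro ⟨b, hb⟩
        exact subset_empty_iff.1 ((inter_subset_inter_right _
          (szlenkIter_antitone _ _ (le_of_lt b.2))).trans hb.subset)
    rw [hset]
    refine .iUnion_countable (one_le_two.trans (h2 a)) fun b => ?_
    refine (ih b.1 b.2 (lt_trans b.2 ha) hC).mono ?_
    gcongr
    exact le_of_lt b.2

end Complexity

end BanachCoding

theorem theorem5p8 (α : Ordinal.{0}) (h1 : 1 ≤ α) (hα : α < Ordinal.omega 1) :
    BanachCoding.IsPi (Ordinal.omega0 ^ α + 1)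
      {μ : BanachCoding.PInfty |
        BanachCoding.szlenkIndex (BanachCoding.X μ) ≤
          ((Ordinal.omega0 ^ α : Ordinal.{0}) : WithTop Ordinal.{0})} := by
  simp only [BanachCoding.szlenkIndex_le_iff, ofPred_forall]
  have h : 1 ≤ Ordinal.omega0 ^ α := Order.one_le_iff_pos.2 (Ordinal.opow_pos α Ordinal.omega0_pos)
  refine BanachCoding.IsPi.iInter_isSigma h fun n => ?_
  -- With `C` the whole space, the condition says that the iterate itself is empty.
  have := BanachCoding.isSigma_setOf_preimage_szlenkIter_eq_empty (ε := 1 / (n + 1))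
    Nat.one_div_pos_of_nat _ (BanachCoding.opow_lt_omega_one hα) isClosed_univ
  simpa [BanachCoding.two_add_four_mul_opow h1] using this
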